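/- Let $Y$ and $X$ be scalar random variables, $W_1$ a random vector in $\mathbb{R}^d$, and suppose the joint distribution $P$ of $(Y,X,W_1)$ is known, with $\operatorname{var}(Y,X,W_1)$ finite and positive definite. Let $W_2$ denote an unobserved scalar random variable. All regressions are population OLS regressions with an intercept. Let $\beta_{\text{med}}$, $\gamma_{1,\text{med}}$ and $R^2_{\text{med}}$ be the coefficient on $X$, the coefficients on $W_1$ and the R-squared in the regression of $Y$ on $(1,X,W_1)$. Let $\pi_1$ be the coefficients on $W_1$ in the regression of $X$ on $(1,W_1)$ and $X^{\perp W_1}=X-\pi_1'W_1$. For a joint distribution of $(Y,X,W_1,W_2)$, let $\beta_{\text{long}}$, $\gamma_{1,\text{long}}$, $\gamma_{2,\text{long}}$ and $R^2_{\text{long}}$ be the coefficients on $X$, $W_1$, $W_2$ and the R-squared in the regression of $Y$ on $(1,X,W_1,W_2)$. For $\delta\in\mathbb{R}$ consider the following assumptions on a joint distribution of $(Y,X,W_1,W_2)$. - A1: $\operatorname{var}(Y,X,W_1,W_2)$ is finite, and $\operatorname{var}(X,W_1,W_2)$ and $\operatorname{var}(Y,X,W_1)$ are positive definite. - A2: $\displaystyle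 \delta\cdot\frac{\operatorname{cov}(X,\gamma_{1,\text{long}}'W_1)}{\operatorname{var}(\gamma_{1,\text{long}}'W_1)}=\frac{\operatorname{cov}(X,\gamma_{2,\text{long}}W_2)}{\operatorname{var}(\gamma_{2,\text{long}}W_2)}$. - A3: $\gamma_{1,\text{long}}\neq 0$ and $\gamma_{2,\text{long}}\neq 0$. - A4: $\operatorname{cov}(W_1,W_2)=0$. - A5: $\operatorname{var}(W_2)=1$. **Theorem.** Let $\delta\in\mathbb{R}$ and $R\in(R^2_{\text{med}},1]$. Let the identified set $\mathcal{B}_I(\delta,R)$ be the set of all $b\in\mathbb{R}$ for which there is a joint distribution of $(Y,X,W_1,W_2)$ whose $(Y,X,W_1)$-marginal is $P$, which satisfies A1–A5 with this $\delta$, and for which $R^2_{\text{long}}=R$ and $\beta_{\text{long}}=b$. Then $$\mathcal{B}_I(\delta,R)=\{b\in\mathbb{R}: f(\beta_{\text{med}}-b,\delta,R)=0\}\setminus\mathcal{B}_{\text{A3fail}},\qquad \mathcal{B}_{\text{A3fail}}=\{b\in\mathbb{R}:\gamma_{1,\text{med}}+(\beta_{\text{med}}-b)\pi_1=0\},$$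 where $f(B,\delta,R)=f_0(B)+\delta\, f_1(B,R)$ with $$f_0(B)=-B\operatorname{var}(X^{\perp W_1})\Big(\operatorname{var}(\gamma_{1,\text{med}}'W_1)+2B\operatorname{cov}(X,\gamma_{1,\text{med}}'W_1)+B^2\operatorname{var}(\pi_1'W_1)\Big),$$ $$\begin{aligned}f_1(B,R)=\;&(R-R^2_{\text{med}})\operatorname{var}(Y)\operatorname{cov}(X,\gamma_{1,\text{med}}'W_1)+B(R-R^2_{\text{med}})\operatorname{var}(Y)\operatorname{var}(\pi_1'W_1)\\&+B^2\operatorname{var}(X^{\perp W_1})\operatorname{cov}(X,\gamma_{1,\text{med}}'W_1)+B^3\operatorname{var}(X^{\perp W_1})\operatorname{var}(\pi_1'W_1).\end{aligned}$$ -/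

import Mathlib

open MeasureTheory ProbabilityTheory
open scoped Matrix

noncomputable section

namespace OmittedVariable

/-! ### Population OLS regression with an intercept -/

section Regression

variable {Ω : Type*} [MeasurableSpace Ω] {ι : Type*} [Fintype ι] [DecidableEq ι]

/-- The regressor vector `(1, Z)`; the index `none` is the constant. -/
def withIntercept (Z : ι → Ω → ℝ) : Option ι → Ω → ℝ
  | none => fun _ => 1
  | some i => Z i

/-- The coefficient vector `E(B B')⁻¹ E(B A)` of the linear projection of `A` on `B = (1, Z)`. -/
def olsCoef (μ : Measure Ω) (A : Ω → ℝ) (Z : ι → Ω → ℝ) : Option ι → ℝ :=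
  (Matrix.of fun i j => ∫ ω, withIntercept Z i ω * withIntercept Z j ω ∂μ)⁻¹ *ᵥ
    fun i => ∫ ω, withIntercept Z i ω * A ω ∂μ

/-- The fitted value (linear projection) of the regression of `A` on `(1, Z)`. -/
def olsFitted (μ : Measure Ω) (A : Ω → ℝ) (Z : ι → Ω → ℝ) : Ω → ℝ :=
  fun ω => ∑ i, olsCoef μ A Z i * withIntercept Z i ω

/-- The population R-squared of the regression of `A` on `(1, Z)`. -/
def rSquared (μ : Measure Ω) (A : Ω → ℝ) (Z : ι → Ω → ℝ) : ℝ :=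
  Var[olsFitted μ A Z; μ] / Var[A; μ]

/-- The variance matrix of the random vector `Z`. -/
def varMatrix (μ : Measure Ω) (Z : ι → Ω → ℝ) : Matrix ι ι ℝ :=
  Matrix.of fun i j => cov[Z i, Z j; μ]

/-- The scalar index `c' Z`. -/
def index (c : ι → ℝ) (Z : ι → Ω → ℝ) : Ω → ℝ := fun ω => ∑ i, c i * Z i ω

end Regression

/-! ### The observed vector `(Y, X, W₁)`, with law `P` -/

/-- Values of `(Y, X, W₁)`. -/
abbrev Obs (d : ℕ) : Type := ℝ × ℝ × (Fin d → ℝ)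

/-- Values of `(Y, X, W₁, W₂)`. -/
abbrev Full (d : ℕ) : Type := ℝ × ℝ × (Fin d → ℝ) × ℝ

section Observed

variable {d : ℕ}

def obsY : Obs d → ℝ := fun z => z.1
def obsX : Obs d → ℝ := fun z => z.2.1
def obsW1 : Fin d → Obs d → ℝ := fun i z => z.2.2 i

/-- The vector `(X, W₁)`, the regressors of the medium regression. -/
def obsXW1 : Unit ⊕ Fin d → Obs d → ℝ := Sum.elim (fun _ => obsX) obsW1

/-- The vector `(Y, X, W₁)`. -/
def obsYXW1 : Unit ⊕ Unit ⊕ Fin d → Obs d → ℝ := Sum.elim (fun _ => obsY) obsXW1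

/-- `var(Y, X, W₁)` is finite and positive definite. -/
structure ObservedRegular (P : Measure (Obs d)) : Prop where
  finite_var : ∀ i, MemLp (obsYXW1 i) 2 P
  posDef : (varMatrix P obsYXW1).PosDef

/-- Coefficient on `X` in the regression of `Y` on `(1, X, W₁)`. -/
def betaMed (P : Measure (Obs d)) : ℝ := olsCoef P obsY obsXW1 (some (Sum.inl ()))

/-- Coefficients on `W₁` in the regression of `Y` on `(1, X, W₁)`. -/
def gammaMed (P : Measure (Obs d)) : Fin d → ℝ :=
  fun i => olsCoef P obsY obsXW1 (some (Sum.inr i))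

/-- R-squared of the regression of `Y` on `(1, X, W₁)`. -/
def rSqMed (P : Measure (Obs d)) : ℝ := rSquared P obsY obsXW1

/-- Coefficients on `W₁` in the regression of `X` on `(1, W₁)`. -/
def piOne (P : Measure (Obs d)) : Fin d → ℝ := fun i => olsCoef P obsX obsW1 (some i)

/-- `X - π₁' W₁`. -/
def xPerp (P : Measure (Obs d)) : Obs d → ℝ := fun z => obsX z - index (piOne P) obsW1 z

def f0 (P : Measure (Obs d)) (B : ℝ) : ℝ :=
  -B * Var[xPerp P; P] *
    (Var[index (gammaMed P) obsW1; P] + 2 * B * cov[obsX, index (gammaMed P) obsW1; P]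
      + B ^ 2 * Var[index (piOne P) obsW1; P])

def f1 (P : Measure (Obs d)) (B R : ℝ) : ℝ :=
  (R - rSqMed P) * Var[obsY; P] * cov[obsX, index (gammaMed P) obsW1; P]
    + B * (R - rSqMed P) * Var[obsY; P] * Var[index (piOne P) obsW1; P]
    + B ^ 2 * Var[xPerp P; P] * cov[obsX, index (gammaMed P) obsW1; P]
    + B ^ 3 * Var[xPerp P; P] * Var[index (piOne P) obsW1; P]

def f (P : Measure (Obs d)) (B δ R : ℝ) : ℝ := f0 P B + δ * f1 P B R

/-- The values `b` of the long coefficient that would force the long coefficients on `W₁`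
to vanish. -/
def A3fail (P : Measure (Obs d)) : Set ℝ :=
  {b | gammaMed P + (betaMed P - b) • piOne P = 0}

end Observed

/-! ### The full vector `(Y, X, W₁, W₂)`, with law `Q`; `W₂` is a scalar -/

section FullVector

variable {d : ℕ}

def fullY : Full d → ℝ := fun z => z.1
def fullX : Full d → ℝ := fun z => z.2.1
def fullW1 : Fin d → Full d → ℝ := fun i z => z.2.2.1 i
def fullW2 : Full d → ℝ := fun z => z.2.2.2

/-- Forgetting `W₂`. -/
def toObs : Full d → Obs d := fun z => (z.1, z.2.1, z.2.2.1)

def fullYXW1 : Unit ⊕ Unit ⊕ Fin d → Full d → ℝ :=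
  Sum.elim (fun _ => fullY) (Sum.elim (fun _ => fullX) fullW1)

/-- The vector `(X, W₁, W₂)`, the regressors of the long regression. -/
def fullXW : Unit ⊕ Fin d ⊕ Unit → Full d → ℝ :=
  Sum.elim (fun _ => fullX) (Sum.elim fullW1 (fun _ => fullW2))

/-- Coefficient on `X` in the regression of `Y` on `(1, X, W₁, W₂)`. -/
def betaLong (Q : Measure (Full d)) : ℝ := olsCoef Q fullY fullXW (some (Sum.inl ()))

/-- Coefficients on `W₁` in the regression of `Y` on `(1, X, W₁, W₂)`. -/
def gammaOneLong (Q : Measure (Full d)) : Fin d → ℝ :=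
  fun i => olsCoef Q fullY fullXW (some (Sum.inr (Sum.inl i)))

/-- Coefficient on `W₂` in the regression of `Y` on `(1, X, W₁, W₂)`. -/
def gammaTwoLong (Q : Measure (Full d)) : ℝ :=
  olsCoef Q fullY fullXW (some (Sum.inr (Sum.inr ())))

/-- R-squared of the regression of `Y` on `(1, X, W₁, W₂)`. -/
def rSqLong (Q : Measure (Full d)) : ℝ := rSquared Q fullY fullXW

/-- The index `γ₁,long' W₁`. -/
def indexOne (Q : Measure (Full d)) : Full d → ℝ := index (gammaOneLong Q) fullW1

/-- The index `γ₂,long W₂`. -/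
def indexTwo (Q : Measure (Full d)) : Full d → ℝ := fun z => gammaTwoLong Q * fullW2 z

/-- Assumptions A1–A5 on the law `Q` of `(Y, X, W₁, W₂)`, for a given value of `δ`. -/
structure Assumptions (Q : Measure (Full d)) (δ : ℝ) : Prop where
  /-- A1: second moments are finite -/
  finite_var_obs : ∀ i, MemLp (fullYXW1 i) 2 Q
  finite_var_unobs : MemLp fullW2 2 Q
  /-- A1: `var(X, W₁, W₂)` is positive definite -/
  posDef_long : (varMatrix Q fullXW).PosDef
  /-- A1: `var(Y, X, W₁)` is positive definite -/
  posDef_obs : (varMatrix Q fullYXW1).PosDef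
  /-- A2: selection on unobservables is `δ` times selection on observables -/
  selection : δ * (cov[fullX, indexOne Q; Q] / Var[indexOne Q; Q])
    = cov[fullX, indexTwo Q; Q] / Var[indexTwo Q; Q]
  /-- A3 -/
  gammaOne_ne : gammaOneLong Q ≠ 0
  gammaTwo_ne : gammaTwoLong Q ≠ 0
  /-- A4: exogenous controls -/
  exogenous : ∀ i, cov[fullW1 i, fullW2; Q] = 0
  /-- A5: normalization -/
  normalized : Var[fullW2; Q] = 1

/-- The (sharp) identified set for the long coefficient: all values of that coefficient over the
laws `Q` of `(Y, X, W₁, W₂)` whose `(Y, X, W₁)`-marginal is the observed law `P`, that satisfy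
A1–A5 with the given `δ`, and whose long R-squared is `R`. -/
def identifiedSet (P : Measure (Obs d)) (δ R : ℝ) : Set ℝ :=
  {b | ∃ Q : Measure (Full d), IsProbabilityMeasure Q ∧ Q.map toObs = P ∧
    Assumptions Q δ ∧ rSqLong Q = R ∧ betaLong Q = b}

end FullVector

end OmittedVariable

end

set_option linter.unusedSectionVars false

/-! Write `B = betaMed - b`, `V = Var[xPerp]`, `s = cov(X, W₂)`, `K = (R - rSqMed) * Var[obsY]`.
When `W₂` has unit variance and is uncorrelated with `W₁`, the normal equations of the long
regression reduce (`long_coef_iff`) to `γ₁ = gammaMed + B π₁`, `γ₂ s = B V` and `cov(Y, W₂) = b s +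
γ₂`. Hence `γ₁` depends only on `P` and `b`, so A3 for `γ₁` is exactly the exclusion of `A3fail`.
The gain in explained variance is `γ₂² - B² V` (`rSqLong_mul_variance`), so prescribing the
R-squared means `γ₂² = K + B² V`.

In A2 the right-hand ratio is therefore `B V / (K + B² V)` and the left-hand one involves only
moments of `P`. Clearing denominators gives `f = 0`, since `f0` is `-B V Var(γ₁'W₁)` and `f1` is
`cov(X, γ₁'W₁) (K + B² V)` (`selection_iff`).

Conversely, for every `b` some `W₂` satisfies all conditions other than A2 and `γ₁ ≠ 0`
(`exists_extension`): a combination of `xPerp`, the medium residual and independent noise. Here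
`rSqMed < R` keeps `W₂` from being collinear with `(X, W₁)`, and `R ≤ 1` makes the noise variance
nonnegative. -/

namespace OmittedVariable

/-! ### Covariances of linear indices and the normal equations of OLS. -/

section Covariance

variable {Ω : Type*} [MeasurableSpace Ω] {ι : Type*} [Fintype ι]
  {μ : Measure Ω} [IsProbabilityMeasure μ] {Z : ι → Ω → ℝ} {A : Ω → ℝ}

lemma memLp_index (hZ : ∀ i, MemLp (Z i) 2 μ) (c : ι → ℝ) : MemLp (index c Z) 2 μ :=
  memLp_finsetSum _ fun i _ => (hZ i).const_mul (c i)

lemma cov_index_right (hA : MemLp A 2 μ) (hZ : ∀ i, MemLp (Z i) 2 μ) (c : ι → ℝ) :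
    cov[A, index c Z; μ] = ∑ i, c i * cov[A, Z i; μ] := by
  unfold index
  rw [covariance_fun_sum_right (fun i => (hZ i).const_mul (c i)) hA]
  simp_rw [covariance_const_mul_right]

lemma cov_index_left (hA : MemLp A 2 μ) (hZ : ∀ i, MemLp (Z i) 2 μ) (c : ι → ℝ) :
    cov[index c Z, A; μ] = ∑ i, c i * cov[Z i, A; μ] := by
  rw [covariance_comm, cov_index_right hA hZ]
  simp_rw [covariance_comm A]

lemma cov_index_add_smul_right (hA : MemLp A 2 μ) (hZ : ∀ i, MemLp (Z i) 2 μ) (c c' : ι → ℝ)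
    (t : ℝ) : cov[A, index (c + t • c') Z; μ] = cov[A, index c Z; μ] + t * cov[A, index c' Z; μ] := by
  simp only [cov_index_right hA hZ, Finset.mul_sum, ← Finset.sum_add_distrib]
  refine Finset.sum_congr rfl fun i _ => ?_
  simp only [Pi.add_apply, Pi.smul_apply, smul_eq_mul]; ring

/-- If two variables have the same covariance with each `Z i`, then so they do with each index. -/
lemma cov_index_congr {A' : Ω → ℝ} (hA : MemLp A 2 μ) (hA' : MemLp A' 2 μ)
    (hZ : ∀ i, MemLp (Z i) 2 μ) (h : ∀ i, cov[Z i, A; μ] = cov[Z i, A'; μ]) (c : ι → ℝ) :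
    cov[index c Z, A; μ] = cov[index c Z, A'; μ] := by
  simp only [cov_index_left hA hZ, cov_index_left hA' hZ, h]

lemma varMatrix_mulVec (hZ : ∀ i, MemLp (Z i) 2 μ) (c : ι → ℝ) (i : ι) :
    (varMatrix μ Z *ᵥ c) i = cov[Z i, index c Z; μ] := by
  rw [cov_index_right (hZ i) hZ]
  simp [varMatrix, Matrix.mulVec, dotProduct, mul_comm]

lemma dotProduct_varMatrix_mulVec (hZ : ∀ i, MemLp (Z i) 2 μ) (c : ι → ℝ) :
    c ⬝ᵥ (varMatrix μ Z *ᵥ c) = Var[index c Z; μ] := by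
  rw [← covariance_self (memLp_index hZ c).aemeasurable, cov_index_left (memLp_index hZ c) hZ]
  simp [dotProduct, varMatrix_mulVec hZ]

/-- The quadratic form of the variance matrix at `c` is the variance of the index `c' Z`. -/
lemma varMatrix_posDef_iff (hZ : ∀ i, MemLp (Z i) 2 μ) :
    (varMatrix μ Z).PosDef ↔ ∀ c : ι → ℝ, c ≠ 0 → 0 < Var[index c Z; μ] := by
  rw [Matrix.posDef_iff_dotProduct_mulVec]
  simp only [star_trivial, dotProduct_varMatrix_mulVec hZ]
  refine and_iff_right_of_imp fun _ => ?_
  ext i j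
  simp [varMatrix, covariance_comm]

lemma eq_of_cov_index_eq (hZ : ∀ i, MemLp (Z i) 2 μ) (hpd : (varMatrix μ Z).PosDef)
    {c c' : ι → ℝ} (h : ∀ i, cov[Z i, index c Z; μ] = cov[Z i, index c' Z; μ]) : c = c' := by
  classical
  refine Matrix.mulVec_injective_iff_isUnit.2 hpd.isUnit (funext fun i => ?_)
  rw [varMatrix_mulVec hZ, varMatrix_mulVec hZ, h i]

variable [DecidableEq ι]

/-- The slope coefficients of the regression of `A` on `(1, Z)`. -/
noncomputable abbrev olsSlope (μ : Measure Ω) (A : Ω → ℝ) (Z : ι → Ω → ℝ) : ι → ℝ :=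
  fun i => olsCoef μ A Z (some i)

lemma integral_mul_eq (hA : MemLp A 2 μ) {C : Ω → ℝ} (hC : MemLp C 2 μ) :
    ∫ ω, A ω * C ω ∂μ = cov[A, C; μ] + (∫ ω, A ω ∂μ) * ∫ ω, C ω ∂μ := by
  rw [covariance_eq_sub hA hC]; simp

lemma integral_index (hZ : ∀ i, MemLp (Z i) 2 μ) (c : ι → ℝ) :
    ∫ ω, index c Z ω ∂μ = ∑ i, c i * ∫ ω, Z i ω ∂μ := by
  unfold index
  rw [integral_finsetSum _ fun i _ => ((hZ i).integrable one_le_two).const_mul (c i)]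
  simp_rw [integral_const_mul]

/-- The second-moment matrix of `(1, Z)`. -/
noncomputable abbrev momentMatrix (μ : Measure Ω) (Z : ι → Ω → ℝ) :
    Matrix (Option ι) (Option ι) ℝ :=
  Matrix.of fun i j => ∫ ω, withIntercept Z i ω * withIntercept Z j ω ∂μ

lemma momentMatrix_mulVec_none (hZ : ∀ i, MemLp (Z i) 2 μ) (x : Option ι → ℝ) :
    (momentMatrix μ Z *ᵥ x) none = x none + ∫ ω, index (fun i => x (some i)) Z ω ∂μ := by
  simp [Matrix.mulVec, dotProduct, Fintype.sum_option, withIntercept, integral_index hZ, mul_comm]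

/-- Splitting each second moment into a covariance and a product of means, the products of means
assemble into a multiple of the intercept row. Subtracting that multiple eliminates the intercept
and leaves equations in covariances alone. -/
lemma momentMatrix_mulVec_some (hZ : ∀ i, MemLp (Z i) 2 μ) (x : Option ι → ℝ) (i : ι) :
    (momentMatrix μ Z *ᵥ x) (some i) = cov[Z i, index (fun i => x (some i)) Z; μ]
      + (∫ ω, Z i ω ∂μ) * (momentMatrix μ Z *ᵥ x) none := by
  rw [momentMatrix_mulVec_none hZ, cov_index_right (hZ i) hZ, integral_index hZ]
  simp only [Matrix.mulVec, dotProduct, Matrix.of_apply, Fintype.sum_option, withIntercept, mul_one,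
    integral_mul_eq (hZ i) (hZ _), add_mul, Finset.sum_add_distrib, mul_add, Finset.mul_sum]
  simp only [mul_comm]
  ring_nf

lemma isUnit_momentMatrix (hZ : ∀ i, MemLp (Z i) 2 μ) (hpd : (varMatrix μ Z).PosDef) :
    IsUnit (momentMatrix μ Z) := by
  rw [← Matrix.mulVec_injective_iff_isUnit]
  intro x y hxy
  have hn := congrFun hxy none
  have hs : (fun i => x (some i)) = fun i => y (some i) := by
    refine eq_of_cov_index_eq hZ hpd fun i => ?_
    have h := congrFun hxy (some i)
    simpa [momentMatrix_mulVec_some hZ, hn] using h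
  rw [momentMatrix_mulVec_none hZ, momentMatrix_mulVec_none hZ, hs] at hn
  funext i
  cases i with
  | none => exact add_right_cancel hn
  | some i => exact congrFun hs i

/-- The normal equations. -/
lemma cov_index_olsSlope (hZ : ∀ i, MemLp (Z i) 2 μ) (hpd : (varMatrix μ Z).PosDef)
    (hA : MemLp A 2 μ) (i : ι) : cov[Z i, index (olsSlope μ A Z) Z; μ] = cov[Z i, A; μ] := by
  have h : momentMatrix μ Z *ᵥ olsCoef μ A Z = fun i => ∫ ω, withIntercept Z i ω * A ω ∂μ := by
    unfold olsCoef
    rw [Matrix.mulVec_mulVec, Matrix.mul_nonsing_inv _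
      ((Matrix.isUnit_iff_isUnit_det _).1 (isUnit_momentMatrix hZ hpd)), Matrix.one_mulVec]
  have hs := congrFun h (some i)
  rw [momentMatrix_mulVec_some hZ, congrFun h none] at hs
  simp only [withIntercept, one_mul, integral_mul_eq (hZ i) hA] at hs
  exact add_right_cancel hs

/-- Nondegeneracy makes the solution of the normal equations unique, so slopes can be identified
from covariances without inverting a matrix. -/
lemma olsSlope_eq_iff (hZ : ∀ i, MemLp (Z i) 2 μ) (hpd : (varMatrix μ Z).PosDef)
    (hA : MemLp A 2 μ) (c : ι → ℝ) :
    olsSlope μ A Z = c ↔ ∀ i, cov[Z i, index c Z; μ] = cov[Z i, A; μ] := by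
  refine ⟨fun h => h ▸ cov_index_olsSlope hZ hpd hA, fun h => ?_⟩
  exact eq_of_cov_index_eq hZ hpd fun i => by rw [cov_index_olsSlope hZ hpd hA, h]

/-- The residual is uncorrelated with every regressor, so the fitted value has the same covariance
with itself as with `A`; the intercept does not affect variances. -/
lemma rSquared_mul_variance (hZ : ∀ i, MemLp (Z i) 2 μ) (hpd : (varMatrix μ Z).PosDef)
    (hA : MemLp A 2 μ) (hpos : Var[A; μ] ≠ 0) :
    rSquared μ A Z * Var[A; μ] = cov[index (olsSlope μ A Z) Z, A; μ] := by
  have hI := memLp_index hZ (olsSlope μ A Z)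
  have : olsFitted μ A Z = fun ω => olsCoef μ A Z none + index (olsSlope μ A Z) Z ω := by
    funext ω
    simp [olsFitted, index, Fintype.sum_option, withIntercept]
  rw [rSquared, div_mul_cancel₀ _ hpos, this, variance_const_add hI.1, ← covariance_self hI.aemeasurable]
  exact cov_index_congr hI hA hZ (cov_index_olsSlope hZ hpd hA) _

end Covariance

/-! ### Moments of the observed law: the medium regression and the two residuals. -/

section ObservedMoments

variable {d : ℕ} {P : Measure (Obs d)} [IsProbabilityMeasure P]

lemma ObservedRegular.memLp_obsY (hP : ObservedRegular P) : MemLp obsY 2 P :=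
  hP.finite_var (Sum.inl ())

lemma ObservedRegular.memLp_obsXW1 (hP : ObservedRegular P) (i) : MemLp (obsXW1 i) 2 P :=
  hP.finite_var (Sum.inr i)

lemma ObservedRegular.memLp_obsX (hP : ObservedRegular P) : MemLp obsX 2 P :=
  hP.memLp_obsXW1 (Sum.inl ())

lemma ObservedRegular.memLp_obsW1 (hP : ObservedRegular P) (i) : MemLp (obsW1 i) 2 P :=
  hP.memLp_obsXW1 (Sum.inr i)

lemma ObservedRegular.memLp_xPerp (hP : ObservedRegular P) : MemLp (xPerp P) 2 P :=
  hP.memLp_obsX.sub (memLp_index hP.memLp_obsW1 _)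

lemma ObservedRegular.posDef_obsXW1 (hP : ObservedRegular P) : (varMatrix P obsXW1).PosDef :=
  hP.posDef.submatrix (e := Sum.inr) Sum.inr_injective

lemma ObservedRegular.posDef_obsW1 (hP : ObservedRegular P) :
    (varMatrix P (obsW1 (d := d))).PosDef :=
  hP.posDef_obsXW1.submatrix (e := Sum.inr) Sum.inr_injective

lemma ObservedRegular.variance_obsY_pos (hP : ObservedRegular P) : 0 < Var[obsY; P] := by
  rw [← covariance_self hP.memLp_obsY.aemeasurable]
  exact hP.posDef.diag_pos (i := Sum.inl ())

lemma ObservedRegular.variance_index_pos (hP : ObservedRegular P) {c : Fin d → ℝ} (hc : c ≠ 0) :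
    0 < Var[index c obsW1; P] :=
  (varMatrix_posDef_iff hP.memLp_obsW1).1 hP.posDef_obsW1 c hc

lemma ObservedRegular.variance_index_add_smul (hP : ObservedRegular P) (c c' : Fin d → ℝ) (t : ℝ) :
    Var[index (c + t • c') obsW1; P] = Var[index c obsW1; P]
      + 2 * t * cov[index c' obsW1, index c obsW1; P] + t ^ 2 * Var[index c' obsW1; P] := by
  have hJ := memLp_index hP.memLp_obsW1
  have h := cov_index_add_smul_right (hJ (c + t • c')) hP.memLp_obsW1 c c' t
  rw [covariance_comm _ (index c obsW1), covariance_comm _ (index c' obsW1),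
    cov_index_add_smul_right (hJ c) hP.memLp_obsW1, cov_index_add_smul_right (hJ c') hP.memLp_obsW1,
    covariance_comm (index c obsW1) (index c' obsW1)] at h
  simp only [covariance_self (hJ _).aemeasurable] at h
  rw [h]
  ring

/-- `xPerp` is an index of `(X, W₁)` whose coefficient on `X` is 1, hence a nonzero one. -/
lemma ObservedRegular.variance_xPerp_pos (hP : ObservedRegular P) : 0 < Var[xPerp P; P] := by
  have h := (varMatrix_posDef_iff hP.memLp_obsXW1).1 hP.posDef_obsXW1
    (Sum.elim (fun _ => 1) (-piOne P)) fun h => one_ne_zero (congrFun h (Sum.inl ()))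
  convert h using 2
  funext z
  simp [xPerp, index, obsXW1, sub_eq_add_neg]

lemma index_olsSlope_obsXW1 (z : Obs d) : index (olsSlope P obsY obsXW1) obsXW1 z
    = betaMed P * obsX z + index (gammaMed P) obsW1 z := by
  simp [index, obsXW1, betaMed, gammaMed, olsSlope]

lemma ObservedRegular.cov_med (hP : ObservedRegular P) {A : Obs d → ℝ} (hA : MemLp A 2 P) :
    cov[A, index (olsSlope P obsY obsXW1) obsXW1; P]
      = betaMed P * cov[A, obsX; P] + cov[A, index (gammaMed P) obsW1; P] := by
  rw [show index (olsSlope P obsY obsXW1) obsXW1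
    = (fun z => betaMed P * obsX z) + index (gammaMed P) obsW1 from funext index_olsSlope_obsXW1,
    covariance_add_right hA (hP.memLp_obsX.const_mul _) (memLp_index hP.memLp_obsW1 _),
    covariance_const_mul_right]

lemma ObservedRegular.cov_obsX_obsY (hP : ObservedRegular P) : cov[obsX, obsY; P]
    = betaMed P * cov[obsX, obsX; P] + cov[obsX, index (gammaMed P) obsW1; P] := by
  rw [← hP.cov_med hP.memLp_obsX]
  exact (cov_index_olsSlope hP.memLp_obsXW1 hP.posDef_obsXW1 hP.memLp_obsY (Sum.inl ())).symm

lemma ObservedRegular.cov_index_obsY (hP : ObservedRegular P) (c : Fin d → ℝ) :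
    cov[index c obsW1, obsY; P]
    = betaMed P * cov[index c obsW1, obsX; P] + cov[index c obsW1, index (gammaMed P) obsW1; P] := by
  rw [← hP.cov_med (memLp_index hP.memLp_obsW1 _)]
  exact cov_index_congr hP.memLp_obsY (memLp_index hP.memLp_obsXW1 _) hP.memLp_obsW1
    (fun i => (cov_index_olsSlope hP.memLp_obsXW1 hP.posDef_obsXW1 hP.memLp_obsY (Sum.inr i)).symm) c

lemma ObservedRegular.cov_obsW1_obsX (hP : ObservedRegular P) (i : Fin d) :
    cov[obsW1 i, obsX; P] = cov[obsW1 i, index (piOne P) obsW1; P] :=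
  (cov_index_olsSlope hP.memLp_obsW1 hP.posDef_obsW1 hP.memLp_obsX i).symm

lemma ObservedRegular.cov_index_obsX (hP : ObservedRegular P) (c : Fin d → ℝ) :
    cov[index c obsW1, obsX; P] = cov[index c obsW1, index (piOne P) obsW1; P] :=
  cov_index_congr hP.memLp_obsX (memLp_index hP.memLp_obsW1 _) hP.memLp_obsW1 hP.cov_obsW1_obsX c

lemma ObservedRegular.cov_obsX_index (hP : ObservedRegular P) (c : Fin d → ℝ) :
    cov[obsX, index c obsW1; P] = cov[index (piOne P) obsW1, index c obsW1; P] := by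
  rw [covariance_comm, hP.cov_index_obsX, covariance_comm]

lemma ObservedRegular.cov_obsW1_obsY (hP : ObservedRegular P) (i : Fin d) :
    cov[obsW1 i, obsY; P]
      = betaMed P * cov[obsW1 i, obsX; P] + cov[obsW1 i, index (gammaMed P) obsW1; P] := by
  rw [← hP.cov_med (hP.memLp_obsW1 i)]
  exact (cov_index_olsSlope hP.memLp_obsXW1 hP.posDef_obsXW1 hP.memLp_obsY (Sum.inr i)).symm

lemma ObservedRegular.cov_obsW1_xPerp (hP : ObservedRegular P) (i : Fin d) :
    cov[obsW1 i, xPerp P; P] = 0 := by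
  unfold xPerp
  rw [covariance_fun_sub_right (hP.memLp_obsW1 i) hP.memLp_obsX (memLp_index hP.memLp_obsW1 _),
    hP.cov_obsW1_obsX, sub_self]

lemma ObservedRegular.cov_index_xPerp (hP : ObservedRegular P) (c : Fin d → ℝ) :
    cov[index c obsW1, xPerp P; P] = 0 := by
  simp [cov_index_left hP.memLp_xPerp hP.memLp_obsW1, hP.cov_obsW1_xPerp]

lemma ObservedRegular.cov_obsX_xPerp (hP : ObservedRegular P) :
    cov[obsX, xPerp P; P] = Var[xPerp P; P] := by
  rw [← covariance_self hP.memLp_xPerp.aemeasurable]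
  refine ((covariance_fun_sub_left hP.memLp_obsX (memLp_index hP.memLp_obsW1 _)
    hP.memLp_xPerp).trans ?_).symm
  rw [hP.cov_index_xPerp, sub_zero]

lemma ObservedRegular.variance_xPerp (hP : ObservedRegular P) :
    Var[xPerp P; P] = cov[obsX, obsX; P]
      - cov[index (piOne P) obsW1, index (piOne P) obsW1; P] := by
  rw [← hP.cov_obsX_xPerp]
  unfold xPerp
  rw [covariance_fun_sub_right hP.memLp_obsX hP.memLp_obsX (memLp_index hP.memLp_obsW1 _),
    hP.cov_obsX_index]

/-- The explained variance of the medium regression. -/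
lemma ObservedRegular.rSqMed_mul_variance (hP : ObservedRegular P) :
    rSqMed P * Var[obsY; P]
      = betaMed P * cov[obsX, obsY; P] + cov[index (gammaMed P) obsW1, obsY; P] := by
  rw [rSqMed, rSquared_mul_variance hP.memLp_obsXW1 hP.posDef_obsXW1 hP.memLp_obsY
    hP.variance_obsY_pos.ne', covariance_comm, hP.cov_med hP.memLp_obsY, covariance_comm obsY,
    covariance_comm obsY]

/-- The residual of the medium regression, up to the intercept. -/
noncomputable def medResidual (P : Measure (Obs d)) : Obs d → ℝ :=
  fun z => obsY z - index (olsSlope P obsY obsXW1) obsXW1 z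

lemma ObservedRegular.memLp_medResidual (hP : ObservedRegular P) : MemLp (medResidual P) 2 P :=
  hP.memLp_obsY.sub (memLp_index hP.memLp_obsXW1 _)

lemma ObservedRegular.cov_obsXW1_medResidual (hP : ObservedRegular P) (i) :
    cov[obsXW1 i, medResidual P; P] = 0 := by
  unfold medResidual
  rw [covariance_fun_sub_right (hP.memLp_obsXW1 i) hP.memLp_obsY (memLp_index hP.memLp_obsXW1 _),
    cov_index_olsSlope hP.memLp_obsXW1 hP.posDef_obsXW1 hP.memLp_obsY, sub_self]

lemma ObservedRegular.cov_obsX_medResidual (hP : ObservedRegular P) :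
    cov[obsX, medResidual P; P] = 0 := hP.cov_obsXW1_medResidual (Sum.inl ())

lemma ObservedRegular.cov_obsW1_medResidual (hP : ObservedRegular P) (i : Fin d) :
    cov[obsW1 i, medResidual P; P] = 0 := hP.cov_obsXW1_medResidual (Sum.inr i)

lemma ObservedRegular.cov_xPerp_medResidual (hP : ObservedRegular P) :
    cov[xPerp P, medResidual P; P] = 0 := by
  unfold xPerp
  rw [covariance_fun_sub_left hP.memLp_obsX (memLp_index hP.memLp_obsW1 _) hP.memLp_medResidual,
    hP.cov_obsX_medResidual, cov_index_left hP.memLp_medResidual hP.memLp_obsW1]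
  simp [hP.cov_obsW1_medResidual]

lemma ObservedRegular.cov_obsY_medResidual (hP : ObservedRegular P) :
    cov[obsY, medResidual P; P] = (1 - rSqMed P) * Var[obsY; P] := by
  unfold medResidual
  rw [covariance_fun_sub_right hP.memLp_obsY hP.memLp_obsY (memLp_index hP.memLp_obsXW1 _),
    sub_mul, one_mul, rSqMed, rSquared_mul_variance hP.memLp_obsXW1 hP.posDef_obsXW1 hP.memLp_obsY
    hP.variance_obsY_pos.ne', covariance_self hP.memLp_obsY.aemeasurable, covariance_comm obsY]

lemma ObservedRegular.variance_medResidual (hP : ObservedRegular P) :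
    Var[medResidual P; P] = (1 - rSqMed P) * Var[obsY; P] := by
  rw [← hP.cov_obsY_medResidual, ← covariance_self hP.memLp_medResidual.aemeasurable]
  refine (covariance_fun_sub_left hP.memLp_obsY (memLp_index hP.memLp_obsXW1 _)
    hP.memLp_medResidual).trans ?_
  rw [cov_index_left hP.memLp_medResidual hP.memLp_obsXW1]
  simp [hP.cov_obsXW1_medResidual]

/-- This is the Frisch–Waugh theorem: `betaMed` is the slope of `Y` on the part of `X` not explained
by `W₁`. -/
lemma ObservedRegular.cov_obsY_xPerp (hP : ObservedRegular P) :
    cov[obsY, xPerp P; P] = betaMed P * Var[xPerp P; P] := by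
  unfold xPerp
  rw [covariance_fun_sub_right hP.memLp_obsY hP.memLp_obsX (memLp_index hP.memLp_obsW1 _),
    covariance_comm obsY, covariance_comm obsY, hP.cov_obsX_obsY, hP.cov_index_obsY,
    hP.cov_index_obsX, hP.cov_obsX_index]
  change _ = _ * Var[xPerp P; P]
  rw [hP.variance_xPerp]
  ring

end ObservedMoments

/-! ### The long regression when `W₂` is exogenous and normalized. -/

section LongRegression

variable {d : ℕ}

lemma measurable_toObs : Measurable (toObs (d := d)) := by unfold toObs; fun_prop

/-- `Q` is the law of `(Y, X, W₁, W₂)` with `(Y, X, W₁)` distributed as `P`, and `W₂` of unit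
variance and uncorrelated with `W₁`. -/
structure IsExogenousExtension (P : Measure (Obs d)) (Q : Measure (Full d)) : Prop where
  map_toObs : Q.map toObs = P
  memLp_fullW2 : MemLp fullW2 2 Q
  exogenous : ∀ i, cov[fullW1 i, fullW2; Q] = 0
  normalized : Var[fullW2; Q] = 1

namespace IsExogenousExtension

variable {P : Measure (Obs d)} {Q : Measure (Full d)}

lemma memLp_comp (h : IsExogenousExtension P Q) {A : Obs d → ℝ} (hA : MemLp A 2 P) :
    MemLp (fun z => A (toObs z)) 2 Q := by
  have hA' := h.map_toObs ▸ hA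
  exact (memLp_map_measure_iff hA'.1 measurable_toObs.aemeasurable).1 hA'

lemma cov_comp (h : IsExogenousExtension P Q) {A C : Obs d → ℝ} (hA : MemLp A 2 P)
    (hC : MemLp C 2 P) : cov[fun z => A (toObs z), fun z => C (toObs z); Q] = cov[A, C; P] := by
  have hA' := h.map_toObs ▸ hA
  have hC' := h.map_toObs ▸ hC
  rw [← h.map_toObs, covariance_map_fun hA'.1 hC'.1 measurable_toObs.aemeasurable]

variable [IsProbabilityMeasure P] [IsProbabilityMeasure Q]
  (hP : ObservedRegular P) (h : IsExogenousExtension P Q)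
include hP h

lemma memLp_fullYXW1 (i) : MemLp (fullYXW1 i) 2 Q := by
  rcases i with i | i | i
  · exact h.memLp_comp hP.memLp_obsY
  · exact h.memLp_comp (hP.memLp_obsXW1 (Sum.inl ()))
  · exact h.memLp_comp (hP.memLp_obsXW1 (Sum.inr i))

lemma memLp_fullY : MemLp fullY 2 Q := h.memLp_fullYXW1 hP (Sum.inl ())

lemma memLp_fullX : MemLp fullX 2 Q := h.memLp_fullYXW1 hP (Sum.inr (Sum.inl ()))

lemma memLp_fullW1 (i) : MemLp (fullW1 i) 2 Q := h.memLp_fullYXW1 hP (Sum.inr (Sum.inr i))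

lemma memLp_fullXW (i) : MemLp (fullXW i) 2 Q := by
  rcases i with i | i | i
  · exact h.memLp_fullX hP
  · exact h.memLp_fullW1 hP i
  · exact h.memLp_fullW2

lemma posDef_fullYXW1 : (varMatrix Q fullYXW1).PosDef := by
  convert hP.posDef using 1
  ext i j
  rw [varMatrix, varMatrix, Matrix.of_apply, Matrix.of_apply,
    ← h.cov_comp (hP.finite_var i) (hP.finite_var j)]
  rcases i with i | i | i <;> rcases j with j | j | j <;> rfl

lemma cov_index_fullW2 (c : Fin d → ℝ) : cov[index c fullW1, fullW2; Q] = 0 := by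
  simp [cov_index_left h.memLp_fullW2 (h.memLp_fullW1 hP), h.exogenous]

lemma cov_long {A : Full d → ℝ} (hA : MemLp A 2 Q) (b g₂ : ℝ) (g₁ : Fin d → ℝ) :
    cov[A, index (Sum.elim (fun _ => b) (Sum.elim g₁ (fun _ => g₂))) fullXW; Q]
      = b * cov[A, fullX; Q] + cov[A, index g₁ fullW1; Q] + g₂ * cov[A, fullW2; Q] := by
  rw [cov_index_right hA (h.memLp_fullXW hP), cov_index_right hA (h.memLp_fullW1 hP)]
  simp [fullXW, add_assoc]

lemma cov_fullX_fullX : cov[fullX, fullX; Q]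
    = Var[xPerp P; P] + cov[index (piOne P) obsW1, index (piOne P) obsW1; P] := by
  rw [hP.variance_xPerp, sub_add_cancel]
  exact h.cov_comp hP.memLp_obsX hP.memLp_obsX

lemma cov_fullX_index (c : Fin d → ℝ) : cov[fullX, index c fullW1; Q]
    = cov[index (piOne P) obsW1, index c obsW1; P] := by
  rw [← hP.cov_obsX_index]
  exact h.cov_comp hP.memLp_obsX (memLp_index hP.memLp_obsW1 c)

lemma cov_index_index (c c' : Fin d → ℝ) : cov[index c fullW1, index c' fullW1; Q]
    = cov[index c obsW1, index c' obsW1; P] :=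
  h.cov_comp (memLp_index hP.memLp_obsW1 c) (memLp_index hP.memLp_obsW1 c')

lemma cov_fullX_fullY : cov[fullX, fullY; Q] = betaMed P * cov[fullX, fullX; Q]
    + cov[index (piOne P) obsW1, index (gammaMed P) obsW1; P] := by
  rw [← hP.cov_obsX_index]
  exact (h.cov_comp hP.memLp_obsX hP.memLp_obsY).trans (hP.cov_obsX_obsY.trans
    (congrArg (betaMed P * · + _) (h.cov_comp hP.memLp_obsX hP.memLp_obsX).symm))

lemma variance_fullY : Var[fullY; Q] = Var[obsY; P] := by
  rw [← covariance_self (h.memLp_fullY hP).aemeasurable,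
    ← covariance_self hP.memLp_obsY.aemeasurable]
  exact h.cov_comp hP.memLp_obsY hP.memLp_obsY

/-- Substitute `X = π₁'W₁ + xPerp`: the `W₁` part is uncorrelated with both `xPerp` and `W₂`, and
`cov(xPerp, W₂) = cov(X, W₂)`. -/
lemma variance_indexLong (b g₂ : ℝ) (g₁ : Fin d → ℝ) :
    Var[index (Sum.elim (fun _ => b) (Sum.elim g₁ (fun _ => g₂))) fullXW; Q]
      = Var[index (g₁ + b • piOne P) obsW1; P] + b ^ 2 * Var[xPerp P; P]
        + 2 * b * g₂ * cov[fullX, fullW2; Q] + g₂ ^ 2 := by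
  have hI := memLp_index (h.memLp_fullXW hP) (Sum.elim (fun _ => b) (Sum.elim g₁ (fun _ => g₂)))
  have hJ := memLp_index hP.memLp_obsW1
  have hJ' := memLp_index (h.memLp_fullW1 hP)
  have hW2 := covariance_self h.memLp_fullW2.aemeasurable
  rw [h.normalized] at hW2
  have e1 : cov[index g₁ fullW1, fullX; Q] = cov[index (piOne P) obsW1, index g₁ obsW1; P] := by
    rw [covariance_comm, h.cov_fullX_index hP]
  have e2 : cov[fullW2, index g₁ fullW1; Q] = 0 := by
    rw [covariance_comm, h.cov_index_fullW2 hP]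
  have e3 : Var[index (g₁ + b • piOne P) obsW1; P] = cov[index g₁ obsW1, index g₁ obsW1; P]
      + 2 * b * cov[index (piOne P) obsW1, index g₁ obsW1; P]
      + b ^ 2 * cov[index (piOne P) obsW1, index (piOne P) obsW1; P] := by
    rw [hP.variance_index_add_smul, covariance_self (hJ _).aemeasurable,
      covariance_self (hJ _).aemeasurable]
  rw [← covariance_self hI.aemeasurable, h.cov_long hP hI, covariance_comm _ fullX,
    covariance_comm _ fullW2, covariance_comm _ (index g₁ fullW1), h.cov_long hP h.memLp_fullW2,
    h.cov_long hP (h.memLp_fullX hP), h.cov_long hP (hJ' _), e1, e2, e3,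
    covariance_comm fullW2 fullX, h.cov_index_fullW2 hP, hW2,
    h.cov_fullX_index hP, h.cov_fullX_fullX hP, h.cov_index_index hP]
  ring

/-- Once `W₁` is partialled out, what remains is the variance matrix of `(xPerp, W₂)`, whose
determinant is `Var[xPerp] - s²`. -/
lemma posDef_fullXW (hs : cov[fullX, fullW2; Q] ^ 2 < Var[xPerp P; P]) :
    (varMatrix Q fullXW).PosDef := by
  rw [varMatrix_posDef_iff (h.memLp_fullXW hP)]
  intro c hc
  obtain ⟨b, g₁, g₂, rfl⟩ : ∃ b g₁ g₂, c = Sum.elim (fun _ => b) (Sum.elim g₁ (fun _ => g₂)) :=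
    ⟨c (Sum.inl ()), fun i => c (Sum.inr (Sum.inl i)), c (Sum.inr (Sum.inr ())), by
      funext i; rcases i with i | i | i <;> rfl⟩
  rw [h.variance_indexLong hP]
  set s := cov[fullX, fullW2; Q]
  have h0 := variance_nonneg (index (g₁ + b • piOne P) obsW1) P
  by_cases hb : b = 0
  · subst hb
    by_cases hg : g₂ = 0
    · subst hg
      have hg₁ : g₁ ≠ 0 := by
        rintro rfl
        exact hc (by funext i; rcases i with i | i | i <;> rfl)
      simpa using hP.variance_index_pos hg₁
    · have := pow_pos (abs_pos.2 hg) 2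
      rw [sq_abs] at this
      linarith
  · have hb2 : 0 < b ^ 2 := by positivity
    -- Completing the square: `b² V + 2 b g₂ s + g₂² = (g₂ + b s)² + b² (V - s²)`.
    nlinarith [sq_nonneg (g₂ + b * s), mul_pos hb2 (sub_pos.2 hs)]

omit hP h [IsProbabilityMeasure P] [IsProbabilityMeasure Q] in
lemma olsSlope_long : olsSlope Q fullY fullXW
    = Sum.elim (fun _ => betaLong Q) (Sum.elim (gammaOneLong Q) (fun _ => gammaTwoLong Q)) := by
  funext i; rcases i with i | i | i <;> rfl

/-- The three conditions come from the `W₁`, `X` and `W₂` rows of the normal equations. Exogeneity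
removes `W₂` from the `W₁` rows, which then determine `g₁` because `var(W₁)` is invertible; unit
variance gives the last `g₂` its coefficient 1. -/
lemma long_coef_iff (hpd : (varMatrix Q fullXW).PosDef) (b g₂ : ℝ) (g₁ : Fin d → ℝ) :
    (betaLong Q = b ∧ gammaOneLong Q = g₁ ∧ gammaTwoLong Q = g₂) ↔
      g₁ = gammaMed P + (betaMed P - b) • piOne P
        ∧ g₂ * cov[fullX, fullW2; Q] = (betaMed P - b) * Var[xPerp P; P]
        ∧ cov[fullY, fullW2; Q] = b * cov[fullX, fullW2; Q] + g₂ := by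
  have hJ := memLp_index hP.memLp_obsW1
  have hW2 := covariance_self h.memLp_fullW2.aemeasurable
  rw [h.normalized] at hW2
  have hols := olsSlope_eq_iff (h.memLp_fullXW hP) hpd (h.memLp_fullY hP)
    (Sum.elim (fun _ => b) (Sum.elim g₁ (fun _ => g₂)))
  have hl : olsSlope Q fullY fullXW = Sum.elim (fun _ => b) (Sum.elim g₁ (fun _ => g₂)) ↔
      betaLong Q = b ∧ gammaOneLong Q = g₁ ∧ gammaTwoLong Q = g₂ := by
    rw [olsSlope_long, Sum.elim_eq_iff, Sum.elim_eq_iff]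
    simp [funext_iff]
  rw [← hl, hols]
  simp only [Sum.forall]
  have hW1 : (∀ i, cov[fullXW (Sum.inr (Sum.inl i)),
      index (Sum.elim (fun _ => b) (Sum.elim g₁ (fun _ => g₂))) fullXW; Q]
        = cov[fullXW (Sum.inr (Sum.inl i)), fullY; Q]) ↔
      g₁ = gammaMed P + (betaMed P - b) • piOne P := by
    have key : ∀ i, (cov[fullXW (Sum.inr (Sum.inl i)),
      index (Sum.elim (fun _ => b) (Sum.elim g₁ (fun _ => g₂))) fullXW; Q]
        = cov[fullXW (Sum.inr (Sum.inl i)), fullY; Q]) ↔ cov[obsW1 i, index g₁ obsW1; P]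
          = cov[obsW1 i, index (gammaMed P + (betaMed P - b) • piOne P) obsW1; P] := by
      intro i
      have hi := hP.memLp_obsW1 i
      change cov[fullW1 i, _; Q] = cov[fullW1 i, fullY; Q] ↔ _
      have e1 : cov[fullW1 i, fullX; Q] = cov[obsW1 i, obsX; P] := h.cov_comp hi hP.memLp_obsX
      have e2 : cov[fullW1 i, fullY; Q] = cov[obsW1 i, obsY; P] := h.cov_comp hi hP.memLp_obsY
      have e3 : cov[fullW1 i, index g₁ fullW1; Q] = cov[obsW1 i, index g₁ obsW1; P] :=
        h.cov_comp hi (hJ _)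
      rw [h.cov_long hP (h.memLp_fullW1 hP i), h.exogenous, e1, e2, e3, hP.cov_obsW1_obsY,
        cov_index_add_smul_right hi hP.memLp_obsW1, hP.cov_obsW1_obsX]
      constructor <;> intro hh <;> linarith
    simp only [key]
    exact ⟨eq_of_cov_index_eq hP.memLp_obsW1 hP.posDef_obsW1, fun hh i => by rw [hh]⟩
  -- The `W₁` rows are moved to the front because the `X` row takes its stated form only after `g₁`
  -- is substituted.
  rw [hW1, and_left_comm]
  refine and_congr_right ?_
  rintro rfl
  refine and_congr ?_ ?_
  · refine Unique.forall_iff.trans ?_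
    change cov[fullX, _; Q] = cov[fullX, fullY; Q] ↔ _
    rw [h.cov_long hP (h.memLp_fullX hP), h.cov_fullX_fullY hP, h.cov_fullX_index hP,
      h.cov_fullX_fullX hP, cov_index_add_smul_right (hJ _) hP.memLp_obsW1]
    constructor <;> intro hh <;> linarith
  · refine Unique.forall_iff.trans ?_
    change cov[fullW2, _; Q] = cov[fullW2, fullY; Q] ↔ _
    rw [h.cov_long hP h.memLp_fullW2, hW2, covariance_comm fullW2 (index _ _),
      h.cov_index_fullW2 hP, covariance_comm fullW2, covariance_comm fullW2]
    constructor <;> intro hh <;> linarith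

/-- The explained variance of the long regression, relative to that of the medium regression. -/
lemma rSqLong_mul_variance (hpd : (varMatrix Q fullXW).PosDef) :
    rSqLong Q * Var[obsY; P] = rSqMed P * Var[obsY; P] + gammaTwoLong Q ^ 2
      - (betaMed P - betaLong Q) ^ 2 * Var[xPerp P; P] := by
  obtain ⟨h1, h2, h3⟩ := (h.long_coef_iff hP hpd _ _ _).1 ⟨rfl, rfl, rfl⟩
  have hJ := memLp_index hP.memLp_obsW1
  have e (c : Fin d → ℝ) : cov[fullY, index c fullW1; Q] = cov[obsY, index c obsW1; P] :=
    h.cov_comp hP.memLp_obsY (hJ c)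
  have hX : cov[obsX, obsY; P] = cov[fullX, fullY; Q] :=
    (h.cov_comp hP.memLp_obsX hP.memLp_obsY).symm
  have hY := h.variance_fullY hP
  have hR : rSqLong Q * Var[fullY; Q] = _ := rSquared_mul_variance (h.memLp_fullXW hP) hpd
    (h.memLp_fullY hP) (hY ▸ hP.variance_obsY_pos.ne')
  rw [hY, olsSlope_long, covariance_comm, h.cov_long hP (h.memLp_fullY hP), e, h3, h1,
    cov_index_add_smul_right hP.memLp_obsY hP.memLp_obsW1, covariance_comm obsY,
    covariance_comm obsY, hP.cov_index_obsY (piOne P), hP.cov_index_obsX, covariance_comm fullY,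
    h.cov_fullX_fullY hP, h.cov_fullX_fullX hP] at hR
  rw [hR, hP.rSqMed_mul_variance, hX, h.cov_fullX_fullY hP, h.cov_fullX_fullX hP]
  -- The only unobserved covariance left is `s`, in the product `b γ₂ s`, which the `X` row turns
  -- into `b B V`.
  linear_combination betaLong Q * h2

end IsExogenousExtension

end LongRegression

/-! ### The selection assumption as a cubic equation. -/

section Selection

variable {d : ℕ} {P : Measure (Obs d)} {Q : Measure (Full d)}
  [IsProbabilityMeasure P] [IsProbabilityMeasure Q]

/-- In terms of observables, the selection assumption is a cubic equation in the omitted variable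
bias. -/
lemma IsExogenousExtension.selection_iff (hP : ObservedRegular P) (h : IsExogenousExtension P Q)
    (hpd : (varMatrix Q fullXW).PosDef) (hg₁ : gammaOneLong Q ≠ 0) (hg₂ : gammaTwoLong Q ≠ 0)
    (δ : ℝ) :
    δ * (cov[fullX, indexOne Q; Q] / Var[indexOne Q; Q])
        = cov[fullX, indexTwo Q; Q] / Var[indexTwo Q; Q]
      ↔ f P (betaMed P - betaLong Q) δ (rSqLong Q) = 0 := by
  obtain ⟨h1, h2, -⟩ := (h.long_coef_iff hP hpd _ _ _).1 ⟨rfl, rfl, rfl⟩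
  have hR := h.rSqLong_mul_variance hP hpd
  have hJ := memLp_index hP.memLp_obsW1
  have hJ' := memLp_index (h.memLp_fullW1 hP)
  have hpos := hP.variance_index_pos hg₁
  have e1 : Var[indexOne Q; Q] = Var[index (gammaOneLong Q) obsW1; P] := by
    rw [indexOne, ← covariance_self (hJ' _).aemeasurable, h.cov_index_index hP,
      covariance_self (hJ _).aemeasurable]
  have e2 : cov[fullX, indexOne Q; Q] = cov[index (piOne P) obsW1, index (gammaMed P) obsW1; P]
      + (betaMed P - betaLong Q) * Var[index (piOne P) obsW1; P] := by
    rw [indexOne, h.cov_fullX_index hP, h1, cov_index_add_smul_right (hJ _) hP.memLp_obsW1,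
      covariance_self (hJ _).aemeasurable]
  have e3 : cov[fullX, indexTwo Q; Q] = (betaMed P - betaLong Q) * Var[xPerp P; P] := by
    unfold indexTwo
    rw [covariance_const_mul_right, h2]
  have e4 : Var[indexTwo Q; Q] = gammaTwoLong Q ^ 2 := by
    unfold indexTwo
    rw [variance_const_mul, h.normalized, mul_one]
  have e5 := hP.variance_index_add_smul (gammaMed P) (piOne P) (betaMed P - betaLong Q)
  rw [← h1] at e5
  rw [e1, e2, e3, e4, ← mul_div_assoc, div_eq_div_iff hpos.ne' (pow_ne_zero 2 hg₂), e5, f, f0, f1,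
    hP.cov_obsX_index, ← sub_eq_zero]
  refine Eq.congr_left ?_
  set c := cov[index (piOne P) obsW1, index (gammaMed P) obsW1; P]
  -- After cross-multiplication, `γ₂²` appears with coefficient `δ cov(X, γ₁'W₁)`; the R-squared
  -- identity replaces it by `K + B² V`.
  linear_combination (-δ * (c + (betaMed P - betaLong Q) * Var[index (piOne P) obsW1; P])) * hR

end Selection

/-! ### Construction of an unobserved variable with prescribed long coefficient and R-squared. -/

section Construction

variable {d : ℕ} {P : Measure (Obs d)} [IsProbabilityMeasure P]

lemma measurable_index_obsW1 (c : Fin d → ℝ) : Measurable (index c (obsW1 (d := d))) := by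
  unfold index obsW1; fun_prop

lemma measurable_xPerp : Measurable (xPerp P) := by
  have := measurable_index_obsW1 (piOne P)
  unfold xPerp obsX; fun_prop

lemma measurable_medResidual : Measurable (medResidual P) := by
  have := measurable_index_obsW1 (gammaMed P)
  unfold medResidual
  simp only [index_olsSlope_obsXW1]
  unfold obsX obsY; fun_prop

/-- An unobserved variable made of the residuals of `X` and `Y` and of noise `t`. -/
noncomputable def unobserved (P : Measure (Obs d)) (a e η : ℝ) (p : Obs d × ℝ) : ℝ :=
  a * xPerp P p.1 + e * medResidual P p.1 + η * p.2

/-- The observed vector completed by `unobserved`. -/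
noncomputable def completion (P : Measure (Obs d)) (a e η : ℝ) (p : Obs d × ℝ) : Full d :=
  (p.1.1, p.1.2.1, p.1.2.2, unobserved P a e η p)

lemma measurable_unobserved (a e η : ℝ) : Measurable (unobserved P a e η) := by
  have h1 := measurable_xPerp (P := P)
  have h2 := measurable_medResidual (P := P)
  unfold unobserved; fun_prop

lemma measurable_completion (a e η : ℝ) : Measurable (completion P a e η) := by
  have := measurable_unobserved (P := P) a e η
  unfold completion; fun_prop

/-- The observed vector together with independent standard Gaussian noise. -/
noncomputable abbrev withNoise (P : Measure (Obs d)) : Measure (Obs d × ℝ) :=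
  P.prod (gaussianReal 0 1)

lemma cov_noise {A : Obs d → ℝ} (hA : MemLp A 2 P) :
    cov[fun p => A p.1, fun p => p.2; withNoise P] = 0 :=
  covariance_fst_snd_prod hA (memLp_id_gaussianReal' 2 (by simp))

lemma cov_noise_left {A : Obs d → ℝ} (hA : MemLp A 2 P) :
    cov[fun p => p.2, fun p => A p.1; withNoise P] = 0 :=
  (covariance_comm _ _).trans (cov_noise hA)

lemma memLp_noise : MemLp (fun p : Obs d × ℝ => p.2) 2 (withNoise P) :=
  (memLp_id_gaussianReal' 2 (by simp)).comp_snd P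

lemma variance_noise : cov[fun p => p.2, fun p => p.2; withNoise P] = 1 := by
  rw [covariance_self measurable_snd.aemeasurable]
  refine (measurePreserving_snd.variance_fun_comp (f := id) aemeasurable_id).trans ?_
  simp [variance_id_gaussianReal]

lemma cov_withNoise {A C : Obs d → ℝ} (hA : MemLp A 2 P) (hC : MemLp C 2 P) :
    cov[fun p => A p.1, fun p => C p.1; withNoise P] = cov[A, C; P] := by
  have hfst : (withNoise P).map Prod.fst = P := measurePreserving_fst.map_eq
  rw [← hfst] at hA hC
  rw [← covariance_map_fun hA.1 hC.1 measurable_fst.aemeasurable, hfst]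

variable (hP : ObservedRegular P) (a e η : ℝ)
include hP

lemma memLp_unobserved : MemLp (unobserved P a e η) 2 (withNoise P) :=
  (((hP.memLp_xPerp.comp_fst _).const_mul a).add
    ((hP.memLp_medResidual.comp_fst _).const_mul e)).add (memLp_noise.const_mul η)

lemma cov_unobserved {A : Obs d × ℝ → ℝ} (hA : MemLp A 2 (withNoise P)) :
    cov[A, unobserved P a e η; withNoise P] = a * cov[A, fun p => xPerp P p.1; withNoise P]
      + e * cov[A, fun p => medResidual P p.1; withNoise P]
      + η * cov[A, fun p => p.2; withNoise P] := by
  have h1 := (hP.memLp_xPerp.comp_fst (gaussianReal 0 1)).const_mul a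
  have h2 := (hP.memLp_medResidual.comp_fst (gaussianReal 0 1)).const_mul e
  refine (covariance_add_right hA (h1.add h2) (memLp_noise.const_mul η)).trans ?_
  rw [covariance_add_right hA h1 h2, covariance_const_mul_right, covariance_const_mul_right,
    covariance_const_mul_right]

lemma cov_obs_unobserved {A : Obs d → ℝ} (hA : MemLp A 2 P) :
    cov[fun p => A p.1, unobserved P a e η; withNoise P]
      = a * cov[A, xPerp P; P] + e * cov[A, medResidual P; P] := by
  rw [cov_unobserved hP a e η (hA.comp_fst _), cov_withNoise hA hP.memLp_xPerp,
    cov_withNoise hA hP.memLp_medResidual, cov_noise hA, mul_zero, add_zero]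

lemma variance_unobserved : Var[unobserved P a e η; withNoise P]
    = a ^ 2 * Var[xPerp P; P] + e ^ 2 * Var[medResidual P; P] + η ^ 2 := by
  have hU := memLp_unobserved hP a e η
  rw [← covariance_self hU.aemeasurable, cov_unobserved hP a e η hU,
    covariance_comm (unobserved P a e η) (fun p => xPerp P p.1),
    covariance_comm (unobserved P a e η) (fun p => medResidual P p.1),
    covariance_comm (unobserved P a e η) (fun p => p.2), cov_obs_unobserved hP a e η hP.memLp_xPerp,
    cov_obs_unobserved hP a e η hP.memLp_medResidual, cov_unobserved hP a e η memLp_noise,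
    cov_noise_left hP.memLp_xPerp, cov_noise_left hP.memLp_medResidual, variance_noise,
    covariance_comm (medResidual P), hP.cov_xPerp_medResidual,
    covariance_self hP.memLp_xPerp.aemeasurable, covariance_self hP.memLp_medResidual.aemeasurable]
  ring

lemma cov_completion {A : Obs d → ℝ} (hA : MemLp A 2 P) (hAm : Measurable A) :
    cov[fun z => A (toObs z), fullW2; (withNoise P).map (completion P a e η)]
      = a * cov[A, xPerp P; P] + e * cov[A, medResidual P; P] := by
  rw [← cov_obs_unobserved hP a e η hA]
  have hW : Measurable (fullW2 (d := d)) := by unfold fullW2; fun_prop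
  exact covariance_map_fun (hAm.comp measurable_toObs).aestronglyMeasurable
    hW.aestronglyMeasurable (measurable_completion a e η).aemeasurable

/-- Exogeneity is automatic, since both residuals and the noise are uncorrelated with `W₁`. Only the
unit variance constrains `a`, `e` and `η`. -/
lemma isExogenousExtension_completion
    (h1 : a ^ 2 * Var[xPerp P; P] + e ^ 2 * Var[medResidual P; P] + η ^ 2 = 1) :
    IsExogenousExtension P ((withNoise P).map (completion P a e η)) := by
  have hm := measurable_completion (P := P) a e η
  have hW : Measurable (fullW2 (d := d)) := by unfold fullW2; fun_prop
  refine ⟨?_, ?_, fun i => ?_, ?_⟩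
  · rw [Measure.map_map measurable_toObs hm]
    exact measurePreserving_fst.map_eq
  · exact (memLp_map_measure_iff hW.aestronglyMeasurable hm.aemeasurable).2
      (memLp_unobserved hP a e η)
  · have hi : Measurable (obsW1 (d := d) i) := by unfold obsW1; fun_prop
    have := cov_completion hP a e η (hP.memLp_obsW1 i) hi
    rw [hP.cov_obsW1_xPerp, hP.cov_obsW1_medResidual, mul_zero, mul_zero, add_zero] at this
    exact this
  · rw [variance_map hW.aemeasurable hm.aemeasurable, ← h1, ← variance_unobserved hP]
    rfl

lemma cov_fullX_completion :
    cov[fullX, fullW2; (withNoise P).map (completion P a e η)] = a * Var[xPerp P; P] := by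
  have := cov_completion hP a e η hP.memLp_obsX (by unfold obsX; fun_prop)
  rwa [hP.cov_obsX_xPerp, hP.cov_obsX_medResidual, mul_zero, add_zero] at this

lemma cov_fullY_completion :
    cov[fullY, fullW2; (withNoise P).map (completion P a e η)]
      = a * (betaMed P * Var[xPerp P; P]) + e * Var[medResidual P; P] := by
  have := cov_completion hP a e η hP.memLp_obsY (by unfold obsY; fun_prop)
  rwa [hP.cov_obsY_xPerp, hP.cov_obsY_medResidual, ← hP.variance_medResidual] at this

/-- Apart from selection, the long coefficient and R-squared are unrestricted. -/
lemma exists_extension {R : ℝ} (hR : R ∈ Set.Ioc (rSqMed P) 1) (b : ℝ) :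
    ∃ Q : Measure (Full d), IsProbabilityMeasure Q ∧ IsExogenousExtension P Q ∧
      (varMatrix Q fullXW).PosDef ∧ rSqLong Q = R ∧ betaLong Q = b ∧
      gammaOneLong Q = gammaMed P + (betaMed P - b) • piOne P ∧ gammaTwoLong Q ≠ 0 := by
  have hV := hP.variance_xPerp_pos
  have hY := hP.variance_obsY_pos
  have hE := hP.variance_medResidual
  set V := Var[xPerp P; P]
  set E := Var[medResidual P; P]
  set B := betaMed P - b
  obtain ⟨K, hK⟩ : ∃ K, K = (R - rSqMed P) * Var[obsY; P] := ⟨_, rfl⟩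
  have hKpos : 0 < K := hK ▸ mul_pos (sub_pos.2 hR.1) hY
  -- The required gain in explained variance cannot exceed the residual variance `E` of the medium
  -- regression; this is where `R ≤ 1` enters.
  have hKE : K ≤ E := by rw [hK, hE]; gcongr; exact hR.2
  have hEpos : 0 < E := hKpos.trans_le hKE
  have hgsq : 0 < K + B ^ 2 * V := by positivity
  -- `g` will be `γ₂`; its square is forced by the R-squared, and the positive root is taken.
  obtain ⟨g, hg, hg2⟩ : ∃ g : ℝ, 0 < g ∧ g ^ 2 = K + B ^ 2 * V :=
    ⟨_, Real.sqrt_pos.2 hgsq, Real.sq_sqrt hgsq.le⟩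
  -- The weight on `xPerp` solves `g (a V) = B V`, so `a = B / g`. The equation for `cov(Y, W₂)`
  -- then gives `e E = K / g`. The noise supplies the variance still missing from 1, which vanishes
  -- when `K = E`, that is, when `R = 1`.
  have hη : 0 ≤ 1 - (B / g) ^ 2 * V - (K / (g * E)) ^ 2 * E := by
    have : 1 - (B / g) ^ 2 * V - (K / (g * E)) ^ 2 * E = K * (E - K) / (g ^ 2 * E) := by
      field_simp
      rw [hg2]; ring
    rw [this]
    have := sub_nonneg.2 hKE
    positivity
  have hm := measurable_completion (P := P) (B / g) (K / (g * E))
    √(1 - (B / g) ^ 2 * V - (K / (g * E)) ^ 2 * E)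
  have hX := cov_fullX_completion hP (B / g) (K / (g * E))
    √(1 - (B / g) ^ 2 * V - (K / (g * E)) ^ 2 * E)
  have hYW := cov_fullY_completion hP (B / g) (K / (g * E))
    √(1 - (B / g) ^ 2 * V - (K / (g * E)) ^ 2 * E)
  have h := isExogenousExtension_completion hP (B / g) (K / (g * E))
    √(1 - (B / g) ^ 2 * V - (K / (g * E)) ^ 2 * E) (by rw [Real.sq_sqrt hη]; ring)
  set Q := (withNoise P).map (completion P (B / g) (K / (g * E))
    √(1 - (B / g) ^ 2 * V - (K / (g * E)) ^ 2 * E))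
  have hQ : IsProbabilityMeasure Q := Measure.isProbabilityMeasure_map hm.aemeasurable
  have hpd : (varMatrix Q fullXW).PosDef := by
    refine h.posDef_fullXW hP ?_
    rw [hX]
    change (B / g * V) ^ 2 < V
    -- Positivity of `K`, hence `rSqMed < R`, is what keeps `W₂` from being collinear with `(X,
    -- W₁)`.
    have : V - (B / g * V) ^ 2 = K * V / g ^ 2 := by
      field_simp
      rw [hg2]; ring
    have : 0 < V - (B / g * V) ^ 2 := by rw [this]; positivity
    linarith
  obtain ⟨hb, hg₁, hg₂⟩ := (h.long_coef_iff hP hpd b g (gammaMed P + B • piOne P)).2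
    ⟨rfl, by rw [hX]; exact (mul_assoc _ _ _).symm.trans (by rw [mul_div_cancel₀ _ hg.ne']), by
      rw [hX, hYW]
      change B / g * (betaMed P * V) + K / (g * E) * E = b * (B / g * V) + g
      have : betaMed P = B + b := (sub_add_cancel _ _).symm
      rw [this]
      field_simp
      rw [hg2]; ring⟩
  refine ⟨Q, hQ, h, hpd, ?_, hb, hg₁, hg₂ ▸ hg.ne'⟩
  have hr := h.rSqLong_mul_variance hP hpd
  rw [hb, hg₂, hg2, hK] at hr
  refine mul_right_cancel₀ hY.ne' (hr.trans ?_)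
  change rSqMed P * Var[obsY; P] + ((R - rSqMed P) * Var[obsY; P] + B ^ 2 * V) - B ^ 2 * V = _
  ring

end Construction

end OmittedVariable

/-! ### The identified set. -/

theorem mainTheorem2 {d : ℕ}
    (P : MeasureTheory.Measure (OmittedVariable.Obs d)) [MeasureTheory.IsProbabilityMeasure P]
    (hP : OmittedVariable.ObservedRegular P)
    (δ R : ℝ) (hR : R ∈ Set.Ioc (OmittedVariable.rSqMed P) 1) :
    OmittedVariable.identifiedSet P δ R =
      {b : ℝ | OmittedVariable.f P (OmittedVariable.betaMed P - b) δ R = 0} \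
        OmittedVariable.A3fail P := by
  ext b
  constructor
  · rintro ⟨Q, hQ, hmap, hA, rfl, rfl⟩
    have h : OmittedVariable.IsExogenousExtension P Q :=
      ⟨hmap, hA.finite_var_unobs, hA.exogenous, hA.normalized⟩
    obtain ⟨h1, -⟩ := (h.long_coef_iff hP hA.posDef_long _ _ _).1 ⟨rfl, rfl, rfl⟩
    exact ⟨(h.selection_iff hP hA.posDef_long hA.gammaOne_ne hA.gammaTwo_ne δ).1 hA.selection,
      fun hfail => hA.gammaOne_ne (h1.trans hfail)⟩
  · rintro ⟨hf, hfail⟩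
    obtain ⟨Q, hQ, h, hpd, rfl, rfl, hg₁, hg₂⟩ := OmittedVariable.exists_extension hP hR b
    -- The long coefficients on `W₁` are the vector whose vanishing defines `A3fail`, so excluding
    -- `b` from that set yields A3.
    have hne : OmittedVariable.gammaOneLong Q ≠ 0 := fun h0 => hfail (hg₁.symm.trans h0)
    exact ⟨Q, hQ, h.map_toObs, ⟨h.memLp_fullYXW1 hP, h.memLp_fullW2, hpd, h.posDef_fullYXW1 hP,
      (h.selection_iff hP hpd hne hg₂ δ).2 hf, hne, hg₂, h.exogenous, h.normalized⟩, rfl, rfl⟩
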